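/- Let $F$ be a field of characteristic zero, let $L$ be an $F$-vector space with a countably infinite basis $e_1,e_2,\dots$, and let $E$ be the Grassmann (exterior) algebra of $L$. Let $m<n$ be integers. Split the basis $\{e_1,e_2,\dots\}$ into two disjoint infinite sets, give each generator in the first set degree $m$ and each generator in the second set degree $n$, and let $E_{(m,n)}^{(\infty,\infty)}=\bigoplus_{r\in\mathbb Z}A_r$ be the resulting $\mathbb Z$-grading on $E$: $A_r$ is the span of the basic monomials $e_{i_1}\cdots e_{i_k}$ ($i_1<\dots<i_k$, $k\ge 0$) whose generators have degrees adding up to $r$. Assume that the grading has full support, i.e. $A_r\neq 0$ for every $r\in\mathbb Z$. Let $c_+$ be the minimum of $\alpha+\beta$ over all integers $\alpha,\beta\ge 0$ with $\alpha m+\beta n=1$, and let $c_-$ be the minimum of $\alpha'+\beta'$ over all integers $\alpha',\beta'\ge 0$ with $\alpha' m+\beta' n=-1$. Assume that either $c_+$ is even and $c_-$ is odd (type (2)), or $c_+$ is odd and $c_-$ is even (type (3)). Let $F\langle X|\mathbb Z\rangle$ be the free associative unitary $F$-algebra on variables $x_i^d$ of degree $d$ ($d\in\mathbb Z$, countably many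 for each $d$), with its natural $\mathbb Z$-grading. Let $T_{\mathbb Z}(E_{(m,n)}^{(\infty,\infty)})$ be the ideal of $\mathbb Z$-graded polynomial identities of $E_{(m,n)}^{(\infty,\infty)}$, i.e. of all polynomials in $F\langle X|\mathbb Z\rangle$ that vanish whenever each variable $x_i^d$ is replaced by an element of $A_d$. Let $\mathfrak V_1^{\mathbb Z}$ be the variety of $\mathbb Z$-graded algebras defined by the identities $[x_1,x_2,x_3]=[[x_1,x_2],x_3]$, for all degrees of the variables $x_1,x_2,x_3$; its ideal $T_{\mathbb Z}(\mathfrak V_1^{\mathbb Z})$ is the smallest two-sided ideal of $F\langle X|\mathbb Z\rangle$ that contains these polynomials and is invariant under all graded endomorphisms of $F\langle X|\mathbb Z\rangle$. Then $E_{(m,n)}^{(\infty,\infty)}$ generates the variety $\mathfrak V_1^{\mathbb Z}$, i.e. $T_{\mathbb Z}(E_{(m,n)}^{(\infty,\infty)})=T_{\mathbb Z}(\mathfrak V_1^{\mathbb Z})$. -/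

import Mathlib

open scoped DirectSum

/-! ### The free graded algebra, graded identities and varieties -/

/-- `F⟨X | ℤ⟩`: the free associative unitary `F`-algebra on the variables `x_i^d`, where the
variable `x_i^d` is indexed by the pair `(d, i)`. -/
abbrev FreeGraded (F : Type*) [Field F] := FreeAlgebra F (ℤ × ℕ)

/-- The variable `x_i^d`, of `ℤ`-degree `d`. -/
def gradedVar (F : Type*) [Field F] (d : ℤ) (i : ℕ) : FreeGraded F := FreeAlgebra.ι F (d, i)

/-- The homogeneous component of degree `d` of `F⟨X | ℤ⟩`: the span of all monomials whose
variables have degrees adding up to `d`. -/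
def freeComponent (F : Type*) [Field F] (d : ℤ) : Submodule F (FreeGraded F) :=
  Submodule.span F {p | ∃ w : List (ℤ × ℕ), (w.map Prod.fst).sum = d ∧
    p = (w.map fun v => gradedVar F v.1 v.2).prod}

/-- A `ℤ`-graded endomorphism of `F⟨X | ℤ⟩`. -/
def IsGradedEndo {F : Type*} [Field F] (φ : FreeGraded F →ₐ[F] FreeGraded F) : Prop :=
  ∀ d : ℤ, ∀ p ∈ freeComponent F d, φ p ∈ freeComponent F d

/-- A `T_ℤ`-ideal: a two-sided ideal of `F⟨X | ℤ⟩` that is invariant under all graded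
endomorphisms. -/
def IsTIdeal {F : Type*} [Field F] (I : TwoSidedIdeal (FreeGraded F)) : Prop :=
  ∀ φ : FreeGraded F →ₐ[F] FreeGraded F, IsGradedEndo φ → ∀ p ∈ I, φ p ∈ I

/-- The `T_ℤ`-ideal generated by a set of graded polynomials. -/
def tIdealSpan {F : Type*} [Field F] (s : Set (FreeGraded F)) : TwoSidedIdeal (FreeGraded F) :=
  sInf {I | IsTIdeal I ∧ s ⊆ {p | p ∈ I}}

theorem isTIdeal_tIdealSpan {F : Type*} [Field F] (s : Set (FreeGraded F)) :
    IsTIdeal (tIdealSpan s) := by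
  intro φ hφ p hp
  rw [tIdealSpan, TwoSidedIdeal.mem_sInf] at hp ⊢
  exact fun I hI => hI.1 φ hφ p (hp I hI)

/-- `T_ℤ(A)`: the ideal of all `ℤ`-graded polynomial identities of a `ℤ`-graded algebra
`A = ⨁ d, 𝒜 d`, that is, of all polynomials vanishing under every substitution of the variables
by elements of the components of the same degree. -/
def gradedIdentities {F A : Type*} [Field F] [Ring A] [Algebra F A] (𝒜 : ℤ → Submodule F A)
    [GradedAlgebra 𝒜] : TwoSidedIdeal (FreeGraded F) :=
  .mk' {p | ∀ a : ℤ × ℕ → A, (∀ v, a v ∈ 𝒜 v.1) → FreeAlgebra.lift F a p = 0}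
    (fun a _ => map_zero _)
    (fun hp hq a ha => by rw [map_add, hp a ha, hq a ha, add_zero])
    (fun hp a ha => by rw [map_neg, hp a ha, neg_zero])
    (fun hq a ha => by rw [map_mul, hq a ha, mul_zero])
    (fun hp a ha => by rw [map_mul, hp a ha, zero_mul])

/-- A variety of `ℤ`-graded `F`-algebras, given by its `T_ℤ`-ideal. -/
structure GradedVariety (F : Type*) [Field F] where
  /-- the `T_ℤ`-ideal of the variety -/
  tIdeal : TwoSidedIdeal (FreeGraded F)
  isTIdeal : IsTIdeal tIdeal

/-- A `ℤ`-graded algebra belongs to the variety if it satisfies all graded identities in the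
`T_ℤ`-ideal of the variety. -/
def GradedVariety.Mem {F A : Type*} [Field F] [Ring A] [Algebra F A] (V : GradedVariety F)
    (𝒜 : ℤ → Submodule F A) [GradedAlgebra 𝒜] : Prop :=
  V.tIdeal ≤ gradedIdentities 𝒜

/-- A `ℤ`-graded algebra generates the variety if its graded identities are exactly the elements of
the `T_ℤ`-ideal of the variety. -/
def GradedVariety.IsGeneratedBy {F A : Type*} [Field F] [Ring A] [Algebra F A]
    (V : GradedVariety F) (𝒜 : ℤ → Submodule F A) [GradedAlgebra 𝒜] : Prop :=
  V.tIdeal = gradedIdentities 𝒜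

/-- The variety `𝔙₁` of `ℤ`-graded algebras defined by the identities
`[x₁, x₂, x₃] = [[x₁, x₂], x₃]`, for all degrees of `x₁`, `x₂`, `x₃`. -/
def varietyOne (F : Type*) [Field F] : GradedVariety F where
  tIdeal := tIdealSpan {p | ∃ a b c : ℤ,
    p = ⁅⁅gradedVar F a 1, gradedVar F b 2⁆, gradedVar F c 3⁆}
  isTIdeal := isTIdeal_tIdealSpan _

/-! ### Gradings on the Grassmann algebra -/

/-- Given a basis `e` of `L` and a degree `δ i` for each generator `e i`, the component of degree
`r` of the Grassmann algebra of `L`: the span of the basic monomials `e_{i_1} ⋯ e_{i_k}`,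
`i_1 < ⋯ < i_k`, with `δ i_1 + ⋯ + δ i_k = r`. -/
noncomputable def grassmannComponent {F L : Type*} [Field F] [AddCommGroup L] [Module F L]
    (e : Module.Basis ℕ F L) (δ : ℕ → ℤ) (r : ℤ) : Submodule F (ExteriorAlgebra F L) :=
  Submodule.span F {w | ∃ s : Finset ℕ, ∑ i ∈ s, δ i = r ∧ w = e.ExteriorAlgebra s}

theorem grassmann_basis_mem {F L : Type*} [Field F] [AddCommGroup L] [Module F L]
    (e : Module.Basis ℕ F L) (δ : ℕ → ℤ) (s : Finset ℕ) :
    e.ExteriorAlgebra s ∈ grassmannComponent e δ (∑ i ∈ s, δ i) :=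
  Submodule.subset_span ⟨s, rfl, rfl⟩

instance grassmannComponent_gradedMonoid {F L : Type*} [Field F] [AddCommGroup L] [Module F L]
    (e : Module.Basis ℕ F L) (δ : ℕ → ℤ) : SetLike.GradedMonoid (grassmannComponent e δ) where
  one_mem := by
    have h := grassmann_basis_mem e δ ∅
    rw [ExteriorAlgebra.basis_apply_ofCard e (n := 0) rfl] at h
    simpa [exteriorPower.ιMulti_family, ExteriorAlgebra.ιMulti_family] using h
  mul_mem := by
    intro i j x y hx hy
    have h : x * y ∈ grassmannComponent e δ i * grassmannComponent e δ j :=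
      Submodule.mul_mem_mul hx hy
    refine (?_ : grassmannComponent e δ i * grassmannComponent e δ j ≤ _) h
    conv_lhs => rw [grassmannComponent, grassmannComponent, Submodule.span_mul_span]
    rw [Submodule.span_le]
    rintro _ ⟨_, ⟨s, rfl, rfl⟩, _, ⟨t, rfl, rfl⟩, rfl⟩
    let s' : Set.powersetCard ℕ s.card := Set.powersetCard.ofCard rfl
    let t' : Set.powersetCard ℕ t.card := Set.powersetCard.ofCard rfl
    change e.ExteriorAlgebra s'.val * e.ExteriorAlgebra t'.val ∈ _
    by_cases hd : Disjoint s'.val t'.val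
    · rw [ExteriorAlgebra.basis_mul_of_disjoint e s' t' hd]
      have h' := grassmann_basis_mem e δ (Set.powersetCard.disjUnion hd).val
      rw [Set.powersetCard.coe_disjUnion, Finset.sum_disjUnion] at h'
      rw [Units.smul_def]
      exact zsmul_mem h' _
    · rw [ExteriorAlgebra.basis_mul_of_not_disjoint e s' t' hd]
      exact Submodule.zero_mem _

/-- The components of the Grassmann algebra attached to a choice of degrees of the generators form
a `ℤ`-grading. -/
noncomputable instance grassmannGrading {F L : Type*} [Field F] [AddCommGroup L] [Module F L]
    (e : Module.Basis ℕ F L) (δ : ℕ → ℤ) : GradedAlgebra (grassmannComponent e δ) where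
  toGradedMonoid := grassmannComponent_gradedMonoid e δ
  toDecomposition := .ofLinearMap (grassmannComponent e δ)
    (e.ExteriorAlgebra.constr F fun s =>
      DirectSum.lof F ℤ (fun r => grassmannComponent e δ r) (∑ i ∈ s, δ i)
        ⟨e.ExteriorAlgebra s, grassmann_basis_mem e δ s⟩)
    (by
      refine e.ExteriorAlgebra.ext fun s => ?_
      simp [Module.Basis.constr_basis])
    (by
      ext r ⟨x, hx⟩ : 2
      simp only [LinearMap.comp_apply, DirectSum.coeLinearMap_lof, LinearMap.id_apply]
      induction hx using Submodule.span_induction with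
      | mem w hw =>
        obtain ⟨s, rfl, rfl⟩ := hw
        rw [Module.Basis.constr_basis]
      | zero => rw [map_zero]; exact (map_zero _).symm
      | add x y hx hy ihx ihy => rw [map_add, ihx, ihy, ← map_add]; rfl
      | smul c x hx ihx => rw [map_smul, ihx, ← map_smul]; rfl)

open Classical in
/-- The degrees of the generators in a `2`-induced grading with lower indexes `m`, `n`: the
generators are split into those indexed by `S`, of degree `m`, and the others, of degree `n`. -/
noncomputable def twoInducedDegree (m n : ℤ) (S : Set ℕ) (i : ℕ) : ℤ := if i ∈ S then m else n

/-- The `2`-induced `ℤ`-grading on the Grassmann algebra of `L` for which the generators `e i` with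
`i ∈ S` have degree `m` and the generators `e i` with `i ∉ S` have degree `n`. It is
`E_{(m, n)}^{(∞, ∞)}` when both `S` and its complement are infinite. -/
noncomputable abbrev twoInduced {F L : Type*} [Field F] [AddCommGroup L] [Module F L]
    (e : Module.Basis ℕ F L) (m n : ℤ) (S : Set ℕ) : ℤ → Submodule F (ExteriorAlgebra F L) :=
  grassmannComponent e (twoInducedDegree m n S)

/-- The support of a `ℤ`-grading. -/
def gradingSupport {F A : Type*} [Field F] [Ring A] [Algebra F A] (𝒜 : ℤ → Submodule F A)
    [GradedAlgebra 𝒜] : Set ℤ :=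
  {r | 𝒜 r ≠ ⊥}

/-- `k` is the minimal value of `α + β` over all `α, β ∈ {0, 1, 2, …}` with `α m + β n = t`. -/
def IsCoefficient (m n t : ℤ) (k : ℕ) : Prop :=
  IsLeast {j : ℕ | ∃ α β : ℕ, (α : ℤ) * m + (β : ℤ) * n = t ∧ α + β = j} k

/-- Type (2): the coefficient for `1` is even and the coefficient for `-1` is odd. -/
def IsTypeTwo (m n : ℤ) : Prop :=
  ∃ k k' : ℕ, IsCoefficient m n 1 k ∧ IsCoefficient m n (-1) k' ∧ Even k ∧ Odd k'

/-- Type (3): the coefficient for `1` is odd and the coefficient for `-1` is even. -/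
def IsTypeThree (m n : ℤ) : Prop :=
  ∃ k k' : ℕ, IsCoefficient m n 1 k ∧ IsCoefficient m n (-1) k' ∧ Odd k ∧ Even k'

/-! Modulo the identity `[p, q, r] = 0`, every polynomial is a combination of the normal forms
`x_{i₁} ⋯ x_{i_k} [x_{j₁}, x_{j₂}] ⋯`, since commutators are central and a product of commutators
is, up to sign, symmetric in the `x_j` and zero if one of them is repeated. So it is enough to show
that no nontrivial combination of normal forms vanishes identically on the Grassmann algebra.

Adding solutions of `α m + β n = 1` and `α m + β n = -1`, whose lengths have opposite parity, gives
monomials of degree `0` and odd length; hence there are monomials of every degree and of either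
parity that avoid any given finite set of generators. Substituting for each variable a sum of such
monomials on disjoint sets of generators, with one even monomial for each occurrence of the variable
among the `x_i` and one odd monomial for an occurrence among the `x_j`, isolates the coefficient of
a minimal normal form. -/

/-! ### Normal forms modulo central commutators -/

section CentralCommutators

attribute [local instance] LieRing.ofAssociativeRing

/-- A ring is *Lie nilpotent of class at most two* if its commutators are central, that is, if it
satisfies the identity `[p, q, r] = 0` defining the variety `𝔙₁`. -/
def HasCentralCommutators (R : Type*) [Ring R] : Prop := ∀ p q r : R, ⁅⁅p, q⁆, r⁆ = 0

theorem lie_lie_mem_of_iSup_eq_top {K R ι : Type*} [CommRing K] [Ring R] [Algebra K R]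
    {𝒜 : ι → Submodule K R} (h𝒜 : ⨆ i, 𝒜 i = ⊤) (N : Submodule K R)
    (h : ∀ i j k, ∀ p ∈ 𝒜 i, ∀ q ∈ 𝒜 j, ∀ r ∈ 𝒜 k, ⁅⁅p, q⁆, r⁆ ∈ N) (p q r : R) :
    ⁅⁅p, q⁆, r⁆ ∈ N := by
  have mem_iSup (x : R) : x ∈ ⨆ i, 𝒜 i := h𝒜 ▸ Submodule.mem_top
  induction mem_iSup p using Submodule.iSup_induction' with
  | zero => simp only [zero_lie, zero_mem]
  | add p p' _ _ hp hp' => simpa only [add_lie] using add_mem hp hp'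
  | mem i p hp =>
    induction mem_iSup q using Submodule.iSup_induction' with
    | zero => simp only [lie_zero, zero_lie, zero_mem]
    | add q q' _ _ hq hq' => simpa only [lie_add, add_lie] using add_mem hq hq'
    | mem j q hq =>
      induction mem_iSup r using Submodule.iSup_induction' with
      | zero => simp only [lie_zero, zero_mem]
      | add r r' _ _ hr hr' => simpa only [lie_add] using add_mem hr hr'
      | mem k r hr => exact h i j k p hp q hq r hr

namespace HasCentralCommutators

variable {R : Type*} [Ring R] (h : HasCentralCommutators R)
include h

theorem commute_lie (p q r : R) : Commute ⁅p, q⁆ r :=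
  commute_iff_lie_eq.mpr (h p q r)

theorem lie_mul_lie_add (a b c d : R) : ⁅a, c⁆ * ⁅b, d⁆ + ⁅a, d⁆ * ⁅b, c⁆ = 0 := by
  have expand : ⁅⁅a * b, c⁆, d⁆ =
      ⁅a, c⁆ * ⁅b, d⁆ + ⁅a, d⁆ * ⁅b, c⁆ + a * ⁅⁅b, c⁆, d⁆ + ⁅⁅a, c⁆, d⁆ * b := by
    simp only [Ring.lie_def]
    noncomm_ring
  simpa only [h _ _ _, mul_zero, zero_mul, add_zero] using expand.symm

theorem lie_mul_lie_swap (p q r s : R) : ⁅p, q⁆ * ⁅r, s⁆ = -(⁅p, r⁆ * ⁅q, s⁆) := by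
  have hrs := h.lie_mul_lie_add p q s r
  have hqr := h.lie_mul_lie_add p r q s
  rw [← lie_skew r q, mul_neg, ← sub_eq_add_neg, sub_eq_zero] at hqr
  rw [hqr, eq_neg_of_add_eq_zero_left hrs]

end HasCentralCommutators

/-- The product `[x₁, x₂][x₃, x₄]⋯` of the commutators of consecutive members of a list, with the
junk value `0` for lists of odd length. -/
def commProd {R V : Type*} [Ring R] (x : V → R) : List V → R
  | [] => 1
  | [_] => 0
  | u :: v :: l => ⁅x u, x v⁆ * commProd x l

section commProd

variable {R V : Type*} [Ring R] (x : V → R)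

theorem map_commProd {R' : Type*} [Ring R'] (f : R →+* R') (l : List V) :
    f (commProd x l) = commProd (f ∘ x) l := by
  induction l using List.twoStepInduction with
  | nil => simp only [commProd, map_one]
  | singleton => simp only [commProd, map_zero]
  | cons_cons u v l ih _ => simp only [commProd, Ring.lie_def, map_mul, map_sub, ih,
      Function.comp_apply]

theorem commProd_of_odd {l : List V} (hl : Odd l.length) : commProd x l = 0 := by
  induction l using List.twoStepInduction with
  | nil => simp at hl
  | singleton => rfl
  | cons_cons u v l ih _ =>
    rw [commProd, ih (by simpa [Nat.odd_add_one] using hl), mul_zero]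

theorem commProd_append {l : List V} (hl : Even l.length) (l' : List V) :
    commProd x (l ++ l') = commProd x l * commProd x l' := by
  induction l using List.twoStepInduction with
  | nil => simp only [List.nil_append, commProd, one_mul]
  | singleton => simp at hl
  | cons_cons u v l ih _ =>
    simp only [List.cons_append, commProd, ih (by simpa [Nat.even_add_one] using hl), mul_assoc]

variable (h : HasCentralCommutators R)
include h

theorem commProd_append_swap (u v : V) (l p : List V) :
    commProd x (p ++ u :: v :: l) = -commProd x (p ++ v :: u :: l) := by
  induction p using List.twoStepInduction with
  | nil => simp only [List.nil_append, commProd, ← neg_mul, lie_skew]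
  | singleton a =>
    cases l with
    | nil => simp only [List.cons_append, List.nil_append, commProd, mul_zero, neg_zero]
    | cons b l =>
      simp only [List.cons_append, List.nil_append, commProd, ← mul_assoc,
        h.lie_mul_lie_swap (x a) (x u), neg_mul]
  | cons_cons a b p ih _ => simp only [List.cons_append, commProd, ih, mul_neg]

theorem exists_commProd_append_eq_smul {l l' : List V} (hl : l.Perm l') (p : List V) :
    ∃ ε : ℤˣ, commProd x (p ++ l) = ε • commProd x (p ++ l') := by
  induction hl generalizing p with
  | nil => exact ⟨1, (one_smul _ _).symm⟩
  | cons a _ ih => simpa using ih (p ++ [a])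
  | swap a b l => exact ⟨-1, by simpa using commProd_append_swap x h b a l p⟩
  | trans _ _ ih ih' =>
    obtain ⟨ε, hε⟩ := ih p
    obtain ⟨ε', hε'⟩ := ih' p
    exact ⟨ε * ε', by rw [hε, hε', mul_smul]⟩

theorem exists_commProd_eq_smul_of_perm {l l' : List V} (hl : l.Perm l') :
    ∃ ε : ℤˣ, commProd x l = ε • commProd x l' :=
  exists_commProd_append_eq_smul x h hl []

theorem commProd_of_not_nodup {l : List V} (hl : ¬ l.Nodup) : commProd x l = 0 := by
  obtain ⟨a, ha⟩ := List.exists_duplicate_iff_not_nodup.mpr hl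
  obtain ⟨l', hl'⟩ := (List.duplicate_iff_sublist.mp ha).exists_perm_append
  obtain ⟨ε, hε⟩ := exists_commProd_append_eq_smul x h hl' []
  simpa only [List.nil_append, List.cons_append, commProd, lie_self, zero_mul, smul_zero] using hε

end commProd

/-- The indices `(a, J)` of the normal forms `x_{i₁} ⋯ x_{i_k} [x_{j₁}, x_{j₂}] ⋯` modulo the
identity `[p, q, r] = 0`: `a` is the multiset of the `i`'s, and `J`, of even size, the set of the
`j`'s. -/
abbrev NormalIndex (V : Type*) := Multiset V × {J : Finset V // Even J.card}

/-- The normal form `x_{i₁} ⋯ x_{i_k} [x_{j₁}, x_{j₂}] ⋯` with a given index. The `i`'s and the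
`j`'s are taken in the arbitrary but fixed orders of `Multiset.toList` and `Finset.toList`. -/
noncomputable def normalMonomial {R V : Type*} [Ring R] (x : V → R) (p : NormalIndex V) : R :=
  (p.1.toList.map x).prod * commProd x p.2.1.toList

section NormalForm

variable {R V : Type*} [Ring R] (x : V → R)

theorem map_normalMonomial {R' : Type*} [Ring R'] (f : R →+* R') (p : NormalIndex V) :
    f (normalMonomial x p) = normalMonomial (f ∘ x) p := by
  rw [normalMonomial, map_mul, map_list_prod, List.map_map, map_commProd, normalMonomial]

variable (K : Type*) [CommRing K] [Algebra K R]

theorem map_linearCombination_normalMonomial {R' : Type*} [Ring R'] [Algebra K R']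
    (f : R →ₐ[K] R') (c : NormalIndex V →₀ K) :
    f (Finsupp.linearCombination K (normalMonomial x) c) =
      Finsupp.linearCombination K (normalMonomial (f ∘ x)) c := by
  rw [← AlgHom.toLinearMap_apply, Finsupp.apply_linearCombination]
  congr 2
  exact funext (map_normalMonomial x f.toRingHom)

theorem adjoin_range_eq_span_words :
    Subalgebra.toSubmodule (Algebra.adjoin K (Set.range x)) =
      Submodule.span K (Set.range fun w : List V => (w.map x).prod) := by
  rw [Algebra.adjoin_eq_span, ← FreeMonoid.mrange_lift, MonoidHom.coe_mrange]
  congr 2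
  exact funext fun w => FreeMonoid.lift_apply x w

/-- The span of the products of fewer than `n` of the `x v` and of any number of commutators. -/
def shortWords (n : ℕ) : Submodule K R :=
  Submodule.span K {r | ∃ u l : List V, u.length < n ∧ Even l.length ∧
    r = (u.map x).prod * commProd x l}

theorem mul_mem_shortWords_succ (v : V) {n : ℕ} {r : R} (hr : r ∈ shortWords x K n) :
    x v * r ∈ shortWords x K (n + 1) := by
  suffices shortWords x K n ≤ (shortWords x K (n + 1)).comap (LinearMap.mulLeft K (x v)) from
    this hr
  refine Submodule.span_le.mpr ?_
  rintro _ ⟨u, l, hu, hl, rfl⟩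
  exact Submodule.subset_span ⟨v :: u, l, Nat.succ_lt_succ hu, hl,
    by simp only [LinearMap.mulLeft_apply, List.map_cons, List.prod_cons, mul_assoc]⟩

variable (h : HasCentralCommutators R)
include h

theorem prod_sub_prod_mem_shortWords {w w' : List V} (hw : w.Perm w') :
    (w.map x).prod - (w'.map x).prod ∈ shortWords x K w.length := by
  induction hw with
  | nil => simp only [sub_self, zero_mem]
  | @cons a w w' _ ih =>
    simpa only [List.map_cons, List.prod_cons, ← mul_sub, List.length_cons] using
      mul_mem_shortWords_succ x K a ih
  | swap a b w =>
    have swap_eq : ((b :: a :: w).map x).prod - ((a :: b :: w).map x).prod =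
        (w.map x).prod * ⁅x b, x a⁆ := by
      rw [← (h.commute_lie _ _ _).eq, Ring.lie_def]
      simp only [List.map_cons, List.prod_cons, sub_mul, mul_assoc]
    exact Submodule.subset_span ⟨w, [b, a], by simp, by simp, by
      rw [swap_eq, commProd, commProd, mul_one]⟩
  | trans hw _ ih ih' =>
    rw [← hw.length_eq] at ih'
    simpa only [sub_add_sub_cancel] using add_mem ih ih'

theorem prod_toList_mul_commProd_mem_span (a : Multiset V) (l : List V) :
    (a.toList.map x).prod * commProd x l ∈
      Submodule.span K (Set.range (normalMonomial x)) := by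
  classical
  rcases l.length.even_or_odd with hl | hl
  · by_cases hd : l.Nodup
    · have hperm : l.Perm l.toFinset.toList := by
        rw [← Multiset.coe_eq_coe, Finset.coe_toList, List.toFinset_val, hd.dedup]
      obtain ⟨ε, hε⟩ := exists_commProd_eq_smul_of_perm x h hperm
      rw [hε, mul_smul_comm, Units.smul_def]
      have hcard : Even l.toFinset.card := by rwa [List.toFinset_card_of_nodup hd]
      let index : NormalIndex V := (a, ⟨l.toFinset, hcard⟩)
      exact zsmul_mem (Submodule.subset_span (Set.mem_range_self index)) _
    · simp only [commProd_of_not_nodup x h hd, mul_zero, zero_mem]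
  · simp only [commProd_of_odd x hl, mul_zero, zero_mem]

theorem prod_mul_commProd_mem_span (w l : List V) :
    (w.map x).prod * commProd x l ∈ Submodule.span K (Set.range (normalMonomial x)) := by
  induction hn : w.length using Nat.strong_induction_on generalizing w l with
  | _ n ih =>
    have hperm : w.Perm (w : Multiset V).toList := by
      rw [← Multiset.coe_eq_coe, Multiset.coe_toList]
    have short_le : shortWords x K n ≤
        (Submodule.span K (Set.range (normalMonomial x))).comap
          (LinearMap.mulRight K (commProd x l)) := by
      refine Submodule.span_le.mpr ?_
      rintro _ ⟨u, l', hu, hl', rfl⟩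
      simpa only [SetLike.mem_coe, Submodule.mem_comap, LinearMap.mulRight_apply, mul_assoc,
        commProd_append x hl'] using ih _ hu u (l' ++ l) rfl
    have sorted := prod_toList_mul_commProd_mem_span x K h w l
    have correction := short_le (hn ▸ prod_sub_prod_mem_shortWords x K h hperm)
    rw [Submodule.mem_comap, LinearMap.mulRight_apply, sub_mul] at correction
    simpa only [sub_add_cancel] using add_mem correction sorted

theorem adjoin_le_span_normalMonomial :
    Subalgebra.toSubmodule (Algebra.adjoin K (Set.range x)) ≤
      Submodule.span K (Set.range (normalMonomial x)) := by
  rw [adjoin_range_eq_span_words, Submodule.span_le]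
  rintro _ ⟨w, rfl⟩
  simpa only [commProd, mul_one, SetLike.mem_coe] using prod_mul_commProd_mem_span x K h w []

end NormalForm

theorem exists_sub_linearCombination_normalMonomial_mem {K V : Type*} [CommRing K]
    (I : TwoSidedIdeal (FreeAlgebra K V)) (hI : ∀ p q r : FreeAlgebra K V, ⁅⁅p, q⁆, r⁆ ∈ I)
    (f : FreeAlgebra K V) :
    ∃ c, f - Finsupp.linearCombination K (normalMonomial (FreeAlgebra.ι K)) c ∈ I := by
  let π : FreeAlgebra K V →ₐ[K] I.ringCon.Quotient := RingCon.mkₐ K I.ringCon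
  have π_eq_iff (p q : FreeAlgebra K V) : π p = π q ↔ p - q ∈ I :=
    (RingCon.eq _).trans (TwoSidedIdeal.rel_iff _ _ _)
  have π_surjective : Function.Surjective π := Quotient.mk''_surjective
  have quotient_central : HasCentralCommutators I.ringCon.Quotient := by
    refine π_surjective.forall₃.mpr fun p q r => ?_
    have lie_eq_zero := (π_eq_iff ⁅⁅p, q⁆, r⁆ 0).mpr (by simpa only [sub_zero] using hI p q r)
    simpa only [Ring.lie_def, map_sub, map_mul, map_zero] using lie_eq_zero
  have hf : π f ∈ Submodule.span K (Set.range (normalMonomial (π ∘ FreeAlgebra.ι K))) := by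
    refine adjoin_le_span_normalMonomial _ K quotient_central ?_
    rw [Set.range_comp, ← AlgHom.map_adjoin, FreeAlgebra.adjoin_range_ι]
    exact ⟨f, trivial, rfl⟩
  obtain ⟨c, hc⟩ := (Finsupp.mem_span_range_iff_exists_finsupp).mp hf
  refine ⟨c, (π_eq_iff _ _).mp ?_⟩
  rw [map_linearCombination_normalMonomial, Finsupp.linearCombination_apply, hc]

end CentralCommutators

/-! ### Separation of normal forms -/

section Anticommuting

attribute [local instance] LieRing.ofAssociativeRing

variable {A V : Type*} [Ring A]

theorem commProd_center_add (z : V → Subring.center A) (θ : V → A) (l : List V) :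
    commProd (fun v => z v + θ v) l = commProd θ l := by
  have lie_eq (u v : V) : ⁅z u + θ u, z v + θ v⁆ = ⁅θ u, θ v⁆ := by
    have z_lie (w : V) (r : A) : ⁅(z w : A), r⁆ = 0 :=
      commute_iff_lie_eq.mp (Subring.mem_center_iff.mp (z w).2 r).symm
    have lie_z (w : V) (r : A) : ⁅r, (z w : A)⁆ = 0 := by rw [← lie_skew, z_lie, neg_zero]
    simp only [add_lie, lie_add, z_lie, lie_z, zero_add]
  induction l using List.twoStepInduction with
  | nil => rfl
  | singleton => rfl
  | cons_cons u v l ih _ => simp only [commProd, lie_eq, ih]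

theorem list_prod_map_center_add_mul {θ : V → A} {r : A} (hr : ∀ v, θ v * r = 0)
    (z : V → Subring.center A) (l : List V) :
    (l.map fun v => z v + θ v).prod * r = (l.map z).prod * r := by
  induction l with
  | nil => simp only [List.map_nil, List.prod_nil, OneMemClass.coe_one]
  | cons v l ih =>
    have θ_mul : θ v * ((l.map z).prod * r) = 0 := by
      rw [← mul_assoc, Subring.mem_center_iff.mp (l.map z).prod.2, mul_assoc, hr, mul_zero]
    simp only [List.map_cons, List.prod_cons, MulMemClass.coe_mul, mul_assoc, ih, add_mul, θ_mul,
      add_zero]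

variable {θ : V → A} (hθ : ∀ u v, θ u * θ v = -(θ v * θ u))
include hθ

theorem commProd_eq_smul_list_prod {l : List V} (hl : Even l.length) :
    commProd θ l = 2 ^ (l.length / 2) • (l.map θ).prod := by
  induction l using List.twoStepInduction with
  | nil => simp only [commProd, List.length_nil, Nat.zero_div, pow_zero, one_smul, List.map_nil,
      List.prod_nil]
  | singleton => simp at hl
  | cons_cons u v l ih _ =>
    have lie_eq : ⁅θ u, θ v⁆ = 2 • (θ u * θ v) := by
      rw [Ring.lie_def, hθ v u, sub_neg_eq_add, two_nsmul]
    have length_div : (u :: v :: l).length / 2 = l.length / 2 + 1 := Nat.add_div_right _ two_pos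
    rw [commProd, ih (by simpa [Nat.even_add_one] using hl), lie_eq, length_div, smul_mul_smul_comm,
      List.map_cons, List.map_cons, List.prod_cons, List.prod_cons, mul_assoc, pow_succ']

theorem mul_list_prod_eq_zero_of_mem {v : V} (hv : θ v * θ v = 0) {l : List V} (hvl : v ∈ l) :
    θ v * (l.map θ).prod = 0 := by
  induction l with
  | nil => simp at hvl
  | cons u l ih =>
    rw [List.map_cons, List.prod_cons, ← mul_assoc]
    rcases List.mem_cons.mp hvl with rfl | hvl
    · rw [hv, zero_mul]
    · rw [hθ, neg_mul, mul_assoc, ih hvl, mul_zero, neg_zero]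

end Anticommuting

section SquareZero

variable {C : Type*} [CommRing C]

theorem add_pow_of_mul_self_eq_zero {u : C} (hu : u * u = 0) (x : C) (n : ℕ) :
    (x + u) ^ n = x ^ n + n * x ^ (n - 1) * u := by
  obtain ⟨k, hk⟩ := Polynomial.powAddExpansion x u n
  rw [hk, pow_two, hu, mul_zero, add_zero]

theorem sum_pow_eq_zero_of_card_lt {ι : Type*} {u : ι → C} (hu : ∀ i, u i * u i = 0)
    {s : Finset ι} {n : ℕ} (hn : s.card < n) : (∑ i ∈ s, u i) ^ n = 0 := by
  induction s using Finset.cons_induction generalizing n with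
  | empty => rw [Finset.sum_empty, zero_pow (Nat.ne_of_gt hn)]
  | cons i s hi ih =>
    rw [Finset.card_cons] at hn
    rw [Finset.sum_cons, add_comm, add_pow_of_mul_self_eq_zero (hu i), ih (by lia),
      ih (by lia), mul_zero, zero_mul, add_zero]

theorem sum_pow_card_eq_factorial_smul_prod {ι : Type*} {u : ι → C} (hu : ∀ i, u i * u i = 0)
    (s : Finset ι) : (∑ i ∈ s, u i) ^ s.card = s.card.factorial • ∏ i ∈ s, u i := by
  induction s using Finset.cons_induction with
  | empty => simp
  | cons i s hi ih =>
    rw [Finset.sum_cons, add_comm, add_pow_of_mul_self_eq_zero (hu i), Finset.card_cons,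
      sum_pow_eq_zero_of_card_lt hu s.card.lt_succ_self, Nat.add_sub_cancel, ih, zero_add,
      Finset.prod_cons, Nat.factorial_succ, nsmul_eq_mul, nsmul_eq_mul, Nat.cast_mul]
    ring

variable {V : Type*} [DecidableEq V] {u : V × ℕ → C} (hu : ∀ p, u p * u p = 0)
include hu

theorem multiset_prod_map_sum_eq_zero {a b : Multiset V} (hab : ¬ a ≤ b) :
    (a.map fun v => ∑ k ∈ Finset.range (b.count v), u (v, k)).prod = 0 := by
  obtain ⟨v, hv⟩ : ∃ v, b.count v < a.count v := by
    simpa only [Multiset.le_iff_count, not_forall, not_le] using hab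
  rw [Finset.prod_multiset_map_count]
  refine Finset.prod_eq_zero (i := v) ?_ ?_
  · exact Multiset.mem_toFinset.mpr (Multiset.count_pos.mp (Nat.zero_lt_of_lt hv))
  · exact sum_pow_eq_zero_of_card_lt (fun k => hu (v, k)) (by rwa [Finset.card_range])

theorem multiset_prod_map_sum_eq_smul (a : Multiset V) :
    (a.map fun v => ∑ k ∈ Finset.range (a.count v), u (v, k)).prod =
      (∏ v ∈ a.toFinset, (a.count v).factorial) • ∏ p ∈ a.toEnumFinset, u p := by
  have factor (v : V) : (∑ k ∈ Finset.range (a.count v), u (v, k)) ^ a.count v =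
      (a.count v).factorial • ∏ k ∈ Finset.range (a.count v), u (v, k) := by
    simpa only [Finset.card_range] using
      sum_pow_card_eq_factorial_smul_prod (fun k => hu (v, k)) (Finset.range (a.count v))
  have prod_enum : ∏ p ∈ a.toEnumFinset, u p =
      ∏ v ∈ a.toFinset, ∏ k ∈ Finset.range (a.count v), u (v, k) := by
    refine Finset.prod_finset_product _ _ _ fun p => ?_
    rw [Multiset.mem_toEnumFinset, Finset.mem_range, Multiset.mem_toFinset, iff_and_self]
    exact fun hp => Multiset.count_pos.mp (Nat.zero_lt_of_lt hp)
  simp only [Finset.prod_multiset_map_count, factor, prod_enum, nsmul_eq_mul, Nat.cast_prod,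
    Finset.prod_mul_distrib]

end SquareZero

/-- A family of central elements `even (v, k)` and anticommuting elements `odd v`, all of square
zero, no product of which vanishes unless a factor is repeated: a copy in `A` of the generators of
a free supercommutative algebra modulo the squares of its even generators. -/
structure FreeSuperFamily (V A : Type*) [Ring A] where
  even : V × ℕ → Subring.center A
  odd : V → A
  even_mul_self : ∀ p, even p * even p = 0
  odd_mul_self : ∀ v, odd v * odd v = 0
  odd_mul_odd : ∀ u v, odd u * odd v = -(odd v * odd u)
  prod_ne_zero : ∀ (K : Finset (V × ℕ)) (J : Finset V),
    ((∏ p ∈ K, even p : Subring.center A) : A) * (J.toList.map odd).prod ≠ 0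

namespace FreeSuperFamily

variable {V A : Type*} [DecidableEq V] [Ring A] (E : FreeSuperFamily V A)

/-- The odd summand of `testPoint`: `odd v` for `v ∈ J`, and `0` otherwise. -/
def oddPart (J : Finset V) (v : V) : A := if v ∈ J then E.odd v else 0

/-- The substitution `v ↦ y_{v,1} + ⋯ + y_{v,a(v)} + θ_v` attached to a normal form with index
`(a, J)`, where the `y`'s are even, `a(v)` is the multiplicity of `v`, and the odd summand `θ_v` is
present only for `v ∈ J`. -/
def testPoint (p : NormalIndex V) (v : V) : A :=
  (∑ k ∈ Finset.range (p.1.count v), E.even (v, k) : Subring.center A) + E.oddPart p.2.1 v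

theorem testPoint_mem {S : V → AddSubmonoid A} (heven : ∀ p, (E.even p : A) ∈ S p.1)
    (hodd : ∀ v, E.odd v ∈ S v) (p : NormalIndex V) (v : V) : E.testPoint p v ∈ S v := by
  refine add_mem ?_ ?_
  · rw [AddSubmonoidClass.coe_finsetSum]
    exact sum_mem fun k _ => heven (v, k)
  · rw [oddPart]
    split_ifs
    exacts [hodd v, zero_mem _]

theorem oddPart_mul_oddPart (J : Finset V) (u v : V) :
    E.oddPart J u * E.oddPart J v = -(E.oddPart J v * E.oddPart J u) := by
  simp only [oddPart]
  split_ifs <;> simp only [E.odd_mul_odd u v, mul_zero, zero_mul, neg_zero]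

theorem oddPart_mul_prod (J : Finset V) (v : V) :
    E.oddPart J v * (J.toList.map (E.oddPart J)).prod = 0 := by
  by_cases hv : v ∈ J
  · refine mul_list_prod_eq_zero_of_mem (E.oddPart_mul_oddPart J) ?_ (Finset.mem_toList.mpr hv)
    rw [oddPart, if_pos hv, E.odd_mul_self]
  · rw [oddPart, if_neg hv, zero_mul]

theorem normalMonomial_testPoint_eq_smul (p q : NormalIndex V) :
    normalMonomial (E.testPoint p) q = 2 ^ (q.2.1.card / 2) •
      ((q.1.toList.map (E.testPoint p)).prod * (q.2.1.toList.map (E.oddPart p.2.1)).prod) := by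
  have hq : Even q.2.1.toList.length := q.2.1.length_toList.symm ▸ q.2.2
  unfold normalMonomial
  rw [← mul_smul_comm, ← q.2.1.length_toList,
    ← commProd_eq_smul_list_prod (E.oddPart_mul_oddPart p.2.1) hq]
  exact congrArg _ (commProd_center_add _ _ _)

theorem list_prod_testPoint_mul_prod (p : NormalIndex V) (a : Multiset V) :
    (a.toList.map (E.testPoint p)).prod * (p.2.1.toList.map (E.oddPart p.2.1)).prod =
      ((a.map fun v => ∑ k ∈ Finset.range (p.1.count v), E.even (v, k)).prod : Subring.center A) *
        (p.2.1.toList.map E.odd).prod := by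
  have oddPart_eq : p.2.1.toList.map (E.oddPart p.2.1) = p.2.1.toList.map E.odd :=
    List.map_congr_left fun v hv => if_pos (Finset.mem_toList.mp hv)
  rw [← Multiset.prod_map_toList, ← oddPart_eq]
  exact list_prod_map_center_add_mul (E.oddPart_mul_prod p.2.1) _ _

theorem subset_of_normalMonomial_testPoint_ne_zero {p q : NormalIndex V}
    (hpq : normalMonomial (E.testPoint p) q ≠ 0) : q.2.1 ⊆ p.2.1 := by
  contrapose! hpq
  obtain ⟨v, hvq, hvp⟩ := Finset.not_subset.mp hpq
  have prod_eq_zero : (q.2.1.toList.map (E.oddPart p.2.1)).prod = 0 :=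
    List.prod_eq_zero (List.mem_map.mpr ⟨v, Finset.mem_toList.mpr hvq, if_neg hvp⟩)
  rw [normalMonomial_testPoint_eq_smul, prod_eq_zero, mul_zero, smul_zero]

theorem le_of_normalMonomial_testPoint_ne_zero {p q : NormalIndex V} (hJ : q.2 = p.2)
    (hpq : normalMonomial (E.testPoint p) q ≠ 0) : q.1 ≤ p.1 := by
  contrapose! hpq
  rw [normalMonomial_testPoint_eq_smul, hJ, list_prod_testPoint_mul_prod,
    multiset_prod_map_sum_eq_zero E.even_mul_self hpq, ZeroMemClass.coe_zero, zero_mul, smul_zero]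

theorem normalMonomial_testPoint_self_ne_zero [IsAddTorsionFree A] (p : NormalIndex V) :
    normalMonomial (E.testPoint p) p ≠ 0 := by
  rw [normalMonomial_testPoint_eq_smul, list_prod_testPoint_mul_prod,
    multiset_prod_map_sum_eq_smul E.even_mul_self, AddSubmonoidClass.coe_nsmul, smul_mul_assoc]
  have factorial_ne_zero : ∏ v ∈ p.1.toFinset, (p.1.count v).factorial ≠ 0 :=
    Finset.prod_ne_zero_iff.mpr fun v _ => Nat.factorial_ne_zero _
  exact smul_ne_zero (pow_ne_zero _ two_ne_zero)
    (smul_ne_zero factorial_ne_zero (E.prod_ne_zero _ _))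

theorem eq_zero_of_linearCombination_testPoint {K : Type*} [CommRing K] [IsDomain K] [CharZero K]
    [Algebra K A] [Module.IsTorsionFree K A] {c : NormalIndex V →₀ K}
    (hc : ∀ p, Finsupp.linearCombination K (normalMonomial (E.testPoint p)) c = 0) : c = 0 := by
  by_contra hc_ne
  -- The lexicographic order compares the sets `J` first, and the multisets `a` only for equal `J`.
  obtain ⟨p, hp, hmin⟩ := c.support.exists_minimalFor
    (fun q : NormalIndex V => toLex q.swap) (Finsupp.support_nonempty_iff.mpr hc_ne)
  have others_vanish (q : NormalIndex V) (hq : q ∈ c.support) (hqp : q ≠ p) :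
      c q • normalMonomial (E.testPoint p) q = 0 := by
    by_contra hne
    have hne' := right_ne_zero_of_smul hne
    have hle : toLex q.swap ≤ toLex p.swap := Prod.Lex.toLex_le_toLex'.mpr
      ⟨E.subset_of_normalMonomial_testPoint_ne_zero hne',
        fun hJ => E.le_of_normalMonomial_testPoint_ne_zero hJ hne'⟩
    exact hqp (Prod.swap_injective (toLex.injective (hle.antisymm (hmin hq hle))))
  have eval_eq : Finsupp.linearCombination K (normalMonomial (E.testPoint p)) c =
      c p • normalMonomial (E.testPoint p) p := by
    rw [Finsupp.linearCombination_apply, Finsupp.sum,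
      Finset.sum_eq_single_of_mem p hp others_vanish]
  have : IsAddTorsionFree A := .of_isTorsionFree K A
  exact smul_ne_zero (Finsupp.mem_support_iff.mp hp) (E.normalMonomial_testPoint_self_ne_zero p)
    (eval_eq.symm.trans (hc p))

end FreeSuperFamily

/-! ### Graded identities -/

section GradedIdentities

variable {F : Type*} [Field F]

theorem ι_mem_freeComponent (v : ℤ × ℕ) : FreeAlgebra.ι F v ∈ freeComponent F v.1 :=
  Submodule.subset_span ⟨[v], by simp, by simp [gradedVar]⟩

theorem iSup_freeComponent : ⨆ d, freeComponent F d = ⊤ := by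
  rw [eq_top_iff, ← Algebra.top_toSubmodule, ← FreeAlgebra.adjoin_range_ι,
    adjoin_range_eq_span_words, Submodule.span_le]
  rintro _ ⟨w, rfl⟩
  exact Submodule.mem_iSup_of_mem _ (Submodule.subset_span ⟨w, rfl, rfl⟩)

theorem freeComponent_gradedMonoid : SetLike.GradedMonoid (freeComponent F) where
  one_mem := Submodule.subset_span ⟨[], by simp, by simp⟩
  mul_mem := by
    intro i j p q hp hq
    have mul_mem_span := Submodule.mul_mem_mul hp hq
    rw [freeComponent, freeComponent, Submodule.span_mul_span] at mul_mem_span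
    refine Submodule.span_mono ?_ mul_mem_span
    rintro _ ⟨_, ⟨w, rfl, rfl⟩, _, ⟨w', rfl, rfl⟩, rfl⟩
    exact ⟨w ++ w', by simp, by simp⟩

theorem lift_mem_of_mem_freeComponent {A : Type*} [Ring A] [Algebra F A]
    {𝒜 : ℤ → Submodule F A} [SetLike.GradedMonoid 𝒜] {a : ℤ × ℕ → A} (ha : ∀ v, a v ∈ 𝒜 v.1)
    {d : ℤ} {p : FreeGraded F} (hp : p ∈ freeComponent F d) : FreeAlgebra.lift F a p ∈ 𝒜 d := by
  suffices freeComponent F d ≤ (𝒜 d).comap (FreeAlgebra.lift F a).toLinearMap from this hp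
  refine Submodule.span_le.mpr ?_
  rintro _ ⟨w, rfl, rfl⟩
  rw [SetLike.mem_coe, Submodule.mem_comap, AlgHom.toLinearMap_apply, map_list_prod, List.map_map]
  refine SetLike.list_prod_map_mem_graded w _ _ fun v _ => ?_
  simpa only [Function.comp_apply, gradedVar, FreeAlgebra.lift_ι_apply] using ha v

theorem lift_mem_of_isTIdeal {I : TwoSidedIdeal (FreeGraded F)} (hI : IsTIdeal I)
    {a : ℤ × ℕ → FreeGraded F} (ha : ∀ v, a v ∈ freeComponent F v.1) {p : FreeGraded F}
    (hp : p ∈ I) : FreeAlgebra.lift F a p ∈ I :=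
  have := freeComponent_gradedMonoid (F := F)
  hI _ (fun _ _ => lift_mem_of_mem_freeComponent ha) p hp

theorem lie_lie_mem_varietyOne (p q r : FreeGraded F) : ⁅⁅p, q⁆, r⁆ ∈ (varietyOne F).tIdeal := by
  refine lie_lie_mem_of_iSup_eq_top iSup_freeComponent
    ((varietyOne F).tIdeal.asIdeal.restrictScalars F) (fun i j k p hp q hq r hr => ?_) p q r
  let a (v : ℤ × ℕ) : FreeGraded F :=
    if v = (i, 1) then p else if v = (j, 2) then q else if v = (k, 3) then r
    else FreeAlgebra.ι F v
  have ha (v : ℤ × ℕ) : a v ∈ freeComponent F v.1 := by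
    simp only [a]
    split_ifs with h₁ h₂ h₃
    · rwa [h₁]
    · rwa [h₂]
    · rwa [h₃]
    · exact ι_mem_freeComponent v
  have generator_mem : ⁅⁅gradedVar F i 1, gradedVar F j 2⁆, gradedVar F k 3⁆ ∈
      (varietyOne F).tIdeal :=
    (TwoSidedIdeal.mem_sInf _).mpr fun I hI => hI.2 ⟨i, j, k, rfl⟩
  have lift_mem := lift_mem_of_isTIdeal (varietyOne F).isTIdeal ha generator_mem
  simpa [Ring.lie_def, gradedVar, a] using lift_mem

variable {A : Type*} [Ring A] [Algebra F A] {𝒜 : ℤ → Submodule F A} [GradedAlgebra 𝒜]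

theorem mem_gradedIdentities {p : FreeGraded F} : p ∈ gradedIdentities 𝒜 ↔
    ∀ a : ℤ × ℕ → A, (∀ v, a v ∈ 𝒜 v.1) → FreeAlgebra.lift F a p = 0 :=
  TwoSidedIdeal.mem_mk' ..

theorem isTIdeal_gradedIdentities : IsTIdeal (gradedIdentities 𝒜) := by
  intro φ hφ p hp
  refine mem_gradedIdentities.mpr fun a ha => ?_
  have lift_comp : (FreeAlgebra.lift F a).comp φ =
      FreeAlgebra.lift F fun v => FreeAlgebra.lift F a (φ (FreeAlgebra.ι F v)) := by
    ext v
    simp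
  rw [← AlgHom.comp_apply, lift_comp]
  exact mem_gradedIdentities.mp hp _
    fun v => lift_mem_of_mem_freeComponent ha (hφ _ _ (ι_mem_freeComponent v))

theorem varietyOne_mem_of_hasCentralCommutators (hA : HasCentralCommutators A) :
    (varietyOne F).Mem 𝒜 := by
  refine sInf_le ⟨isTIdeal_gradedIdentities, ?_⟩
  rintro _ ⟨i, j, k, rfl⟩
  refine mem_gradedIdentities.mpr fun a _ => ?_
  simpa only [Ring.lie_def, map_sub, map_mul] using hA _ _ _

theorem varietyOne_isGeneratedBy_of_freeSuperFamily [CharZero F] (hA : HasCentralCommutators A)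
    (E : FreeSuperFamily (ℤ × ℕ) A) (heven : ∀ p, (E.even p : A) ∈ 𝒜 p.1.1)
    (hodd : ∀ v, E.odd v ∈ 𝒜 v.1) : (varietyOne F).IsGeneratedBy 𝒜 := by
  have mem_variety : (varietyOne F).tIdeal ≤ gradedIdentities 𝒜 :=
    varietyOne_mem_of_hasCentralCommutators hA
  refine mem_variety.antisymm fun f hf => ?_
  obtain ⟨c, hc⟩ := exists_sub_linearCombination_normalMonomial_mem _ lie_lie_mem_varietyOne f
  have normalForm_mem : Finsupp.linearCombination F (normalMonomial (FreeAlgebra.ι F)) c ∈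
      gradedIdentities 𝒜 := by
    simpa only [sub_sub_cancel] using sub_mem hf (mem_variety hc)
  have c_eq_zero : c = 0 := by
    refine E.eq_zero_of_linearCombination_testPoint fun p => ?_
    have testPoint_mem := E.testPoint_mem (S := fun v => (𝒜 v.1).toAddSubmonoid) heven hodd p
    rw [← mem_gradedIdentities.mp normalForm_mem _ testPoint_mem,
      map_linearCombination_normalMonomial, FreeAlgebra.ι_comp_lift]
  simpa only [c_eq_zero, map_zero, sub_zero] using hc

end GradedIdentities

/-! ### Exterior algebras -/

section ExteriorPower

attribute [local instance] LieRing.ofAssociativeRing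

variable {R M : Type*} [CommRing R] [AddCommGroup M] [Module R M]

variable (R M) in
theorem iSup_exteriorPower : ⨆ n : ℕ, ⋀[R]^n M = ⊤ :=
  (DirectSum.Decomposition.isInternal fun n : ℕ => ⋀[R]^n M).submodule_iSup_eq_top

theorem exteriorPower_mul_ι {n : ℕ} {x : ExteriorAlgebra R M} (hx : x ∈ ⋀[R]^n M) (m : M) :
    x * ExteriorAlgebra.ι R m = (-1 : ℤˣ) ^ n • (ExteriorAlgebra.ι R m * x) := by
  induction hx using Submodule.pow_induction_on_left' with
  | algebraMap r => rw [pow_zero, one_smul, Algebra.commutes]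
  | add x y n _ _ ihx ihy => rw [add_mul, mul_add, smul_add, ihx, ihy]
  | mem_mul a ha n x _ ih =>
    obtain ⟨a, rfl⟩ := ha
    have swap : ExteriorAlgebra.ι R a * ExteriorAlgebra.ι R m =
        -(ExteriorAlgebra.ι R m * ExteriorAlgebra.ι R a) :=
      eq_neg_of_add_eq_zero_left (ExteriorAlgebra.ι_add_mul_swap a m)
    rw [mul_assoc, ih, mul_smul_comm, ← mul_assoc, swap, neg_mul, mul_assoc, smul_neg,
      ← Units.neg_smul, Nat.succ_eq_add_one, pow_succ, mul_neg_one]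

theorem exteriorPower_mul_comm {i j : ℕ} {x y : ExteriorAlgebra R M} (hx : x ∈ ⋀[R]^i M)
    (hy : y ∈ ⋀[R]^j M) : x * y = (-1 : ℤˣ) ^ (i * j) • (y * x) := by
  induction hy using Submodule.pow_induction_on_left' with
  | algebraMap r => rw [mul_zero, pow_zero, one_smul, Algebra.commutes]
  | add y z n _ _ ihy ihz => rw [add_mul, mul_add, smul_add, ihy, ihz]
  | mem_mul a ha n y _ ih =>
    obtain ⟨a, rfl⟩ := ha
    rw [← mul_assoc, exteriorPower_mul_ι hx, smul_mul_assoc, mul_assoc, ih, mul_smul_comm,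
      smul_smul, ← mul_assoc, Nat.succ_eq_add_one, mul_add_one, add_comm, pow_add]

theorem exteriorPower_commute {i j : ℕ} (hij : Even (i * j)) {x y : ExteriorAlgebra R M}
    (hx : x ∈ ⋀[R]^i M) (hy : y ∈ ⋀[R]^j M) : Commute x y := by
  rw [Commute, SemiconjBy, exteriorPower_mul_comm hx hy, hij.neg_one_pow, one_smul]

theorem exteriorPower_anticommute {i j : ℕ} (hi : Odd i) (hj : Odd j) {x y : ExteriorAlgebra R M}
    (hx : x ∈ ⋀[R]^i M) (hy : y ∈ ⋀[R]^j M) : x * y = -(y * x) := by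
  rw [exteriorPower_mul_comm hx hy, (hi.mul hj).neg_one_pow, Units.neg_smul, one_smul]

theorem mem_center_of_mem_exteriorPower {n : ℕ} (hn : Even n) {x : ExteriorAlgebra R M}
    (hx : x ∈ ⋀[R]^n M) : x ∈ Subring.center (ExteriorAlgebra R M) := by
  refine Subring.mem_center_iff.mpr fun y => ?_
  have hy : y ∈ ⨆ n : ℕ, ⋀[R]^n M := iSup_exteriorPower R M ▸ Submodule.mem_top
  induction hy using Submodule.iSup_induction' with
  | mem i y hy => exact exteriorPower_commute (hn.mul_left i) hy hx
  | zero => rw [zero_mul, mul_zero]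
  | add y z _ _ ihy ihz => rw [add_mul, mul_add, ihy, ihz]

theorem hasCentralCommutators_exteriorAlgebra : HasCentralCommutators (ExteriorAlgebra R M) := by
  intro p q r
  refine (Submodule.mem_bot R).mp (lie_lie_mem_of_iSup_eq_top (iSup_exteriorPower R M) ⊥
    ?_ p q r)
  intro i j k p hp q hq r hr
  rw [Submodule.mem_bot]
  rcases (i * j).even_or_odd with hij | hij
  · rw [commute_iff_lie_eq.mp (exteriorPower_commute hij hp hq), zero_lie]
  · have hadd : Even (i + j) := (Nat.odd_mul.mp hij).1.add_odd (Nat.odd_mul.mp hij).2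
    have lie_mem : ⁅p, q⁆ ∈ ⋀[R]^(i + j) M :=
      sub_mem (SetLike.mul_mem_graded hp hq) (add_comm j i ▸ SetLike.mul_mem_graded hq hp)
    exact commute_iff_lie_eq.mp (exteriorPower_commute (hadd.mul_right k) lie_mem hr)

end ExteriorPower

section ExteriorBasis

variable {R M I : Type*} [CommRing R] [AddCommGroup M] [Module R M] [LinearOrder I]
  (e : Module.Basis I R M)

theorem exteriorBasis_mem (s : Finset I) : e.ExteriorAlgebra s ∈ ⋀[R]^s.card M := by
  have basis_eq := ExteriorAlgebra.basis_eq_coe_basis e (Set.powersetCard.ofCard (s := s) rfl)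
  exact basis_eq ▸ SetLike.coe_mem _

theorem exteriorBasis_empty : e.ExteriorAlgebra ∅ = 1 := by
  rw [ExteriorAlgebra.basis_apply_ofCard e (n := 0) rfl]
  simp [ExteriorAlgebra.ιMulti_family]

theorem exteriorBasis_mul_of_disjoint {s t : Finset I} (hst : Disjoint s t) :
    ∃ ε : ℤˣ, e.ExteriorAlgebra s * e.ExteriorAlgebra t = ε • e.ExteriorAlgebra (s ∪ t) := by
  have mul_eq := ExteriorAlgebra.basis_mul_of_disjoint e (Set.powersetCard.ofCard (s := s) rfl)
    (Set.powersetCard.ofCard (s := t) rfl) hst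
  exact ⟨_, mul_eq.trans (congrArg _ (congrArg _ (Finset.disjUnion_eq_union s t hst)))⟩

theorem exteriorBasis_mul_self {s : Finset I} (hs : s.Nonempty) :
    e.ExteriorAlgebra s * e.ExteriorAlgebra s = 0 :=
  ExteriorAlgebra.basis_mul_of_not_disjoint e (Set.powersetCard.ofCard (s := s) rfl)
    (Set.powersetCard.ofCard (s := s) rfl) (disjoint_self.not.mpr hs.ne_empty)

theorem exists_list_prod_exteriorBasis_eq_smul {l : List (Finset I)} (hl : l.Pairwise Disjoint) :
    ∃ ε : ℤˣ, (l.map e.ExteriorAlgebra).prod = ε • e.ExteriorAlgebra (l.toFinset.sup id) := by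
  induction l with
  | nil => exact ⟨1, by simp [exteriorBasis_empty]⟩
  | cons s l ih =>
    rw [List.pairwise_cons] at hl
    obtain ⟨ε, hε⟩ := ih hl.2
    have hdisj : Disjoint s (l.toFinset.sup id) :=
      Finset.disjoint_sup_right.mpr fun t ht => hl.1 t (List.mem_toFinset.mp ht)
    obtain ⟨ε', hε'⟩ := exteriorBasis_mul_of_disjoint e hdisj
    refine ⟨ε * ε', ?_⟩
    rw [List.map_cons, List.prod_cons, hε, mul_smul_comm, hε', smul_smul, List.toFinset_cons,
      Finset.sup_insert, id, Finset.sup_eq_union]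

theorem list_prod_exteriorBasis_ne_zero [Nontrivial R] {l : List (Finset I)}
    (hl : l.Pairwise Disjoint) : (l.map e.ExteriorAlgebra).prod ≠ 0 := by
  obtain ⟨ε, hε⟩ := exists_list_prod_exteriorBasis_eq_smul e hl
  rw [hε, Ne, smul_eq_zero_iff_eq]
  exact e.ExteriorAlgebra.ne_zero _

end ExteriorBasis

/-- The free supercommuting family of basis monomials of an exterior algebra on pairwise disjoint
sets of generators, those of even size playing the role of the even generators. -/
noncomputable def exteriorSuperFamily {R M I V : Type*} [CommRing R] [Nontrivial R]
    [AddCommGroup M] [Module R M] [LinearOrder I] (e : Module.Basis I R M)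
    (s : (V × ℕ) ⊕ V → Finset I) (hs : Pairwise (Function.onFun Disjoint s))
    (hnonempty : ∀ p, (s (.inl p)).Nonempty) (heven : ∀ p, Even (s (.inl p)).card)
    (hodd : ∀ v, Odd (s (.inr v)).card) : FreeSuperFamily V (ExteriorAlgebra R M) where
  even p := ⟨e.ExteriorAlgebra (s (.inl p)),
    mem_center_of_mem_exteriorPower (heven p) (exteriorBasis_mem e _)⟩
  odd v := e.ExteriorAlgebra (s (.inr v))
  even_mul_self p := Subtype.ext (exteriorBasis_mul_self e (hnonempty p))
  odd_mul_self v := exteriorBasis_mul_self e (Finset.card_pos.mp (hodd v).pos)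
  odd_mul_odd u v := exteriorPower_anticommute (hodd u) (hodd v) (exteriorBasis_mem e _)
    (exteriorBasis_mem e _)
  prod_ne_zero K J := by
    have nodup : (K.toList.map Sum.inl ++ J.toList.map Sum.inr).Nodup := by
      refine (K.nodup_toList.map Sum.inl_injective).append (J.nodup_toList.map Sum.inr_injective) ?_
      simp [List.Disjoint]
    have disjoint : ((K.toList.map Sum.inl ++ J.toList.map Sum.inr).map s).Pairwise Disjoint :=
      List.pairwise_map.mpr (nodup.imp fun hij => hs hij)
    have prod_ne_zero := list_prod_exteriorBasis_ne_zero e disjoint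
    rw [← Finset.prod_map_toList, SubmonoidClass.coe_list_prod]
    simpa only [List.map_append, List.map_map, List.prod_append, Function.comp_def] using
      prod_ne_zero

/-! ### Disjoint monomials of prescribed degree and parity -/

theorem exists_seq_pairwise_disjoint {α : Type*} {P : ℕ → Finset α → Prop}
    (h : ∀ n T, ∃ s, Disjoint s T ∧ P n s) :
    ∃ s : ℕ → Finset α, (∀ n, P n (s n)) ∧ Pairwise (Function.onFun Disjoint s) := by
  classical
  choose f hf hP using h
  let U (n : ℕ) : Finset α := Nat.rec ∅ (fun k T => T ∪ f k T) n
  have U_mono : Monotone U := monotone_nat_of_le_succ fun _ => Finset.subset_union_left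
  refine ⟨fun n => f n (U n), fun n => hP n _, (pairwise_disjoint_on _).mpr fun m n hmn => ?_⟩
  have subset_U : f m (U m) ⊆ U n := Finset.subset_union_right.trans (U_mono hmn)
  exact (hf n (U n)).symm.mono_left subset_U

theorem exists_pairwise_disjoint {ι α : Type*} [Countable ι] {P : ι → Finset α → Prop}
    (h : ∀ i T, ∃ s, Disjoint s T ∧ P i s) :
    ∃ s : ι → Finset α, (∀ i, P i (s i)) ∧ Pairwise (Function.onFun Disjoint s) := by
  cases isEmpty_or_nonempty ι
  · exact ⟨isEmptyElim, isEmptyElim, fun i => isEmptyElim i⟩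
  · obtain ⟨φ, hφ⟩ := exists_surjective_nat ι
    obtain ⟨s, hs, hdisj⟩ := exists_seq_pairwise_disjoint fun n => h (φ n)
    refine ⟨s ∘ Function.surjInv hφ, fun i => ?_,
      hdisj.comp_of_injective (Function.injective_surjInv hφ)⟩
    simpa only [Function.comp_apply, Function.surjInv_eq hφ i] using hs (Function.surjInv hφ i)

/-- Generators of degrees `δ i` have *odd monomials in all degrees* if every integer is the degree
of a product of an odd number of distinct generators, avoiding any given finite set of them. -/
def HasOddMonomials (δ : ℕ → ℤ) : Prop :=
  ∀ (d : ℤ) (T : Finset ℕ), ∃ s, Disjoint s T ∧ Odd s.card ∧ ∑ i ∈ s, δ i = d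

theorem HasOddMonomials.exists_even {δ : ℕ → ℤ} (hδ : HasOddMonomials δ) (d : ℤ) (T : Finset ℕ) :
    ∃ s, Disjoint s T ∧ s.Nonempty ∧ Even s.card ∧ ∑ i ∈ s, δ i = d := by
  obtain ⟨s, hsT, hs, hs_sum⟩ := hδ 0 T
  obtain ⟨t, htTs, ht, ht_sum⟩ := hδ d (T ∪ s)
  obtain ⟨htT, hts⟩ := Finset.disjoint_union_right.mp htTs
  refine ⟨s ∪ t, Finset.disjoint_union_left.mpr ⟨hsT, htT⟩,
    (Finset.card_pos.mp hs.pos).mono Finset.subset_union_left, ?_, ?_⟩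
  · rw [Finset.card_union_of_disjoint hts.symm]
    exact hs.add_odd ht
  · rw [Finset.sum_union hts.symm, hs_sum, ht_sum, zero_add]

theorem exists_odd_combination {m n : ℤ} (htype : IsTypeTwo m n ∨ IsTypeThree m n) (d : ℤ) :
    ∃ α β : ℕ, α * m + β * n = d ∧ Odd (α + β) := by
  obtain ⟨α, β, α', β', pos_eq, neg_eq, hodd⟩ : ∃ α β α' β' : ℕ, α * m + β * n = 1 ∧
      α' * m + β' * n = -1 ∧ Odd (α + β + (α' + β')) := by
    rcases htype with ⟨_, _, ⟨⟨α, β, hpos, rfl⟩, _⟩, ⟨⟨α', β', hneg, rfl⟩, _⟩, heven, hodd⟩ |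
      ⟨_, _, ⟨⟨α, β, hpos, rfl⟩, _⟩, ⟨⟨α', β', hneg, rfl⟩, _⟩, hodd, heven⟩
    · exact ⟨α, β, α', β', hpos, hneg, heven.add_odd hodd⟩
    · exact ⟨α, β, α', β', hpos, hneg, hodd.add_even heven⟩
  obtain ⟨α₀, β₀, d_eq⟩ : ∃ α₀ β₀ : ℕ, α₀ * m + β₀ * n = d := by
    obtain ⟨k, rfl | rfl⟩ := d.eq_nat_or_neg
    · exact ⟨k * α, k * β, by push_cast; linear_combination k * pos_eq⟩
    · exact ⟨k * α', k * β', by push_cast; linear_combination k * neg_eq⟩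
  rcases (α₀ + β₀).even_or_odd with heven | hodd₀
  · refine ⟨α₀ + (α + α'), β₀ + (β + β'), ?_, ?_⟩
    · push_cast
      linear_combination d_eq + pos_eq + neg_eq
    · convert heven.add_odd hodd using 1
      ring
  · exact ⟨α₀, β₀, d_eq, hodd₀⟩

theorem hasOddMonomials_twoInducedDegree {m n : ℤ} {S : Set ℕ} (hS : S.Infinite)
    (hS' : Sᶜ.Infinite) (htype : IsTypeTwo m n ∨ IsTypeThree m n) :
    HasOddMonomials (twoInducedDegree m n S) := by
  intro d T
  obtain ⟨α, β, hd, hodd⟩ := exists_odd_combination htype d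
  obtain ⟨A, hA, rfl⟩ := (hS.sdiff T.finite_toSet).exists_subset_card_eq α
  obtain ⟨B, hB, rfl⟩ := (hS'.sdiff T.finite_toSet).exists_subset_card_eq β
  have hAB : Disjoint A B := Finset.disjoint_left.mpr fun i hiA hiB => (hB hiB).1 (hA hiA).1
  have sum_A : ∑ i ∈ A, twoInducedDegree m n S i = A.card * m := by
    have degree_eq (i) (hi : i ∈ A) : twoInducedDegree m n S i = m := if_pos (hA hi).1
    rw [Finset.sum_congr rfl degree_eq, Finset.sum_const, nsmul_eq_mul]
  have sum_B : ∑ i ∈ B, twoInducedDegree m n S i = B.card * n := by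
    have degree_eq (i) (hi : i ∈ B) : twoInducedDegree m n S i = n := if_neg (hB hi).1
    rw [Finset.sum_congr rfl degree_eq, Finset.sum_const, nsmul_eq_mul]
  refine ⟨A ∪ B, Finset.disjoint_union_left.mpr ⟨?_, ?_⟩, ?_, ?_⟩
  · exact Finset.disjoint_left.mpr fun i hi => (hA hi).2
  · exact Finset.disjoint_left.mpr fun i hi => (hB hi).2
  · rwa [Finset.card_union_of_disjoint hAB]
  · rw [Finset.sum_union hAB, sum_A, sum_B, hd]

theorem proposition3p9_general {F L : Type*} [Field F] [CharZero F] [AddCommGroup L] [Module F L]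
    (e : Module.Basis ℕ F L) {δ : ℕ → ℤ} (hδ : HasOddMonomials δ) :
    (varietyOne F).IsGeneratedBy (grassmannComponent e δ) := by
  obtain ⟨s, hs, hdisj⟩ := exists_pairwise_disjoint
    (P := Sum.elim
      (fun (p : (ℤ × ℕ) × ℕ) s => s.Nonempty ∧ Even s.card ∧ ∑ i ∈ s, δ i = p.1.1)
      (fun (v : ℤ × ℕ) s => Odd s.card ∧ ∑ i ∈ s, δ i = v.1))
    (Sum.rec (fun p => hδ.exists_even p.1.1) (fun v => hδ v.1))
  obtain ⟨hs_even, hs_odd⟩ := Sum.forall.mp hs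
  have monomial_mem {t : Finset ℕ} {d : ℤ} (ht : ∑ i ∈ t, δ i = d) :
      e.ExteriorAlgebra t ∈ grassmannComponent e δ d := ht ▸ grassmann_basis_mem e δ t
  exact varietyOne_isGeneratedBy_of_freeSuperFamily hasCentralCommutators_exteriorAlgebra
    (exteriorSuperFamily e s hdisj (fun p => (hs_even p).1) (fun p => (hs_even p).2.1)
      fun v => (hs_odd v).1)
    (fun p => monomial_mem (hs_even p).2.2) (fun v => monomial_mem (hs_odd v).2)

theorem proposition3p9 {F L : Type*} [Field F] [CharZero F] [AddCommGroup L] [Module F L]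
    (e : Module.Basis ℕ F L) (m n : ℤ) (hmn : m < n)
    (S : Set ℕ) (hS : S.Infinite) (hS' : Sᶜ.Infinite)
    (hfull : gradingSupport (twoInduced e m n S) = Set.univ)
    (htype : IsTypeTwo m n ∨ IsTypeThree m n) :
    (varietyOne F).IsGeneratedBy (twoInduced e m n S) :=
  proposition3p9_general e (hasOddMonomials_twoInducedDegree hS hS' htype)
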